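/- Let $G$ be a second countable, locally compact Hausdorff groupoid with unit space $G^{(0)}$, range and source maps $r,s:G\to G^{(0)}$, and $G^x=r^{-1}(x)$ for $x\in G^{(0)}$. Suppose that $G$ has a continuous Haar system $\lambda=(\lambda^x)_{x\in G^{(0)}}$, i.e. each $\lambda^x$ is a positive Radon measure on $G^x$ with support $G^x$, the function $x\mapsto\int f\,d\lambda^x$ is continuous for every $f\in C_c(G)$, and $\int f(\gamma\gamma')\,d\lambda^{s(\gamma)}(\gamma')=\int f(\gamma')\,d\lambda^{r(\gamma)}(\gamma')$ for all $\gamma\in G$ and $f\in C_c(G)$. Let $\psi:G\to\mathbb{R}$ be a continuous function conditionally of negative type: for each $x\in G^{(0)}$ the kernel $\psi_x(\gamma,\gamma')=\psi(\gamma^{-1}\gamma')$ on $G^x\times G^x$ vanishes on the diagonal, is symmetric, and satisfies $\sum_{i,j}\psi_x(\gamma_i,\gamma_j)\zeta_i\zeta_j\le 0$ for all $n\ge1$, all $\gamma_1,\dots,\gamma_n\in G^x$ and all $\zeta_1,\dots,\zeta_n\in\mathbb{R}$ with $\sum_i\zeta_i=0$. A continuous $G$-Hilbert bundle is a real Hilbert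 bundle $E=\coprod_x E_x$ over $G^{(0)}$ in the sense of Fell and Doran (the total space is Hausdorff; the projection onto $G^{(0)}$ is continuous and open; each fibre $E_x$ is a real Hilbert space; the norm, the fibrewise addition and the multiplication by each scalar are continuous; and a net whose base points converge to $x$ and whose norms tend to $0$ converges to $0\in E_x$), together with linear isometries $L(\gamma):E_{s(\gamma)}\to E_{r(\gamma)}$, $\gamma\in G$, which respect units and products and for which $(\gamma,v)\mapsto L(\gamma)v$ is continuous on $\{(\gamma,v):v\in E_{s(\gamma)}\}$. A continuous cocycle $c:G\to r^*E$ is a continuous map $c:G\to E$ with $c(\gamma)\in E_{r(\gamma)}$ for all $\gamma$ and $c(\gamma\gamma')=c(\gamma)+L(\gamma)c(\gamma')$ whenever $s(\gamma)=r(\gamma')$. Then: 1. There exists a pair $(E,c)$ consisting of a continuous $G$-Hilbert bundle $E$ and a continuous cocycle $c:G\to r^*E$ such that (a) $\psi(\gamma)=\|c(\gamma)\|^2$ for all $\gamma\in G$; (b) for all $x\in G^{(0)}$, the set $\{c(\gamma):\gamma\in G^x\}$ is total in $E_x$ (its linear span is dense). 2. If $(E,c)$ and $(E',c')$ are two pairs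 satisfying (a) and (b), there exists a continuous $G$-equivariant bundle map $u:E\to E'$, linear and isometric on each fibre, such that $c'=u\circ c$. -/

import Mathlib

open CategoryTheory MeasureTheory Topology Filter

universe u v w w'

/-! ## Locally compact groupoids and Haar systems

A groupoid is given by Mathlib's `Groupoid` structure on its unit space `X`; its set of arrows is
`Arr X`. An arrow `γ : x ⟶ y` has source `x` and range `y`, and the product `γ γ'` of arrows with
`s(γ) = r(γ')` is `γ' ≫ γ`. -/

/-- The set `G` of all arrows of a groupoid with unit space `X`. -/
structure Arr (X : Type*) [Groupoid X] where
  {src : X}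
  {rng : X}
  hom : src ⟶ rng

/-- The set `G^x` of arrows with range `x`. -/
structure RFibre {X : Type*} [Groupoid X] (x : X) where
  {src : X}
  hom : src ⟶ x

/-- The inclusion of `G^x` in `G`. -/
def RFibre.toArr {X : Type*} [Groupoid X] {x : X} (γ : RFibre x) : Arr X := ⟨γ.hom⟩

/-- The set of pairs `(γ, γ')` in `G × G` with `s(γ) = r(γ')`. -/
structure ComposablePair (X : Type*) [Groupoid X] where
  {x : X}
  {y : X}
  {z : X}
  left : y ⟶ z
  right : x ⟶ y

/-- The inclusion of the set of composable pairs in `G × G`. -/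
def ComposablePair.toProd {X : Type*} [Groupoid X] (p : ComposablePair X) : Arr X × Arr X :=
  (⟨p.left⟩, ⟨p.right⟩)

section Topology

variable {X : Type*} [Groupoid X] [TopologicalSpace (Arr X)]

/-- `G^x` has the subspace topology. -/
instance (x : X) : TopologicalSpace (RFibre x) :=
  TopologicalSpace.induced RFibre.toArr inferInstance

instance (x : X) : MeasurableSpace (RFibre x) := borel _

instance (x : X) : BorelSpace (RFibre x) := ⟨rfl⟩

/-- The set of composable pairs has the subspace topology of `G × G`. -/
instance : TopologicalSpace (ComposablePair X) :=
  TopologicalSpace.induced ComposablePair.toProd inferInstance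

end Topology

/-- A topological groupoid: all structure maps are continuous. Since `r` is a continuous left
inverse of the continuous map `x ↦ 𝟙 x`, the latter is a topological embedding, so the topology
of `X` is the subspace topology of the set of units of `G`. -/
class IsTopologicalGroupoid (X : Type*) [Groupoid X] [TopologicalSpace X]
    [TopologicalSpace (Arr X)] : Prop where
  continuous_src : Continuous fun γ : Arr X => γ.src
  continuous_rng : Continuous fun γ : Arr X => γ.rng
  continuous_unit : Continuous fun x : X => (⟨𝟙 x⟩ : Arr X)
  continuous_inv : Continuous fun γ : Arr X => (⟨Groupoid.inv γ.hom⟩ : Arr X)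
  continuous_mul : Continuous fun p : ComposablePair X => (⟨p.right ≫ p.left⟩ : Arr X)

/-- Left translation `γ' ↦ γ γ'` from `G^{s(γ)}` to `G^{r(γ)}`. -/
def RFibre.translate {X : Type*} [Groupoid X] {x y : X} (γ : x ⟶ y) (γ' : RFibre x) :
    RFibre y := ⟨γ'.hom ≫ γ⟩

/-- The arrow `γ⁻¹ γ'`, for `γ, γ'` in `G^x`. -/
def RFibre.invMul {X : Type*} [Groupoid X] {x : X} (γ γ' : RFibre x) : Arr X :=
  ⟨γ'.hom ≫ Groupoid.inv γ.hom⟩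

/-- A continuous (left) Haar system: Radon measures `lam x` on `G^x` with full support, such that
`x ↦ ∫ f d(lam x)` is continuous for every `f` in `C_c(G)`, and which are left invariant. -/
structure HaarSystem (X : Type*) [Groupoid X] [TopologicalSpace X] [TopologicalSpace (Arr X)] where
  lam : ∀ x : X, Measure (RFibre x)
  regular : ∀ x, (lam x).Regular
  full_support : ∀ x, (lam x).IsOpenPosMeasure
  continuous_integral : ∀ f : Arr X → ℝ, Continuous f → HasCompactSupport f →
    Continuous fun x => ∫ γ, f γ.toArr ∂(lam x)
  left_invariant : ∀ f : Arr X → ℝ, Continuous f → HasCompactSupport f →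
    ∀ {x y : X} (γ : x ⟶ y),
      ∫ γ', f (γ'.translate γ).toArr ∂(lam x) = ∫ γ', f γ'.toArr ∂(lam y)

/-! ## Functions conditionally of negative type -/

/-- A real kernel conditionally of negative type on a set. -/
structure IsCNTKernel {S : Type*} (k : S → S → ℝ) : Prop where
  diag : ∀ x, k x x = 0
  symm : ∀ x y, k y x = k x y
  sum_nonpos : ∀ (n : ℕ) (ζ : Fin n → ℝ) (x : Fin n → S), ∑ i, ζ i = 0 →
    ∑ i, ∑ j, k (x i) (x j) * ζ i * ζ j ≤ 0

/-- A real function on a groupoid is conditionally of negative type if `(γ, γ') ↦ ψ(γ⁻¹ γ')` is a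
kernel conditionally of negative type on each `G^x`. -/
def IsCNT {X : Type*} [Groupoid X] (ψ : Arr X → ℝ) : Prop :=
  ∀ x : X, IsCNTKernel fun γ γ' : RFibre x => ψ (γ.invMul γ')

/-! ## Hilbert bundles -/

/-- The fibred product `E * E` over the base. -/
structure FibrePair {X : Type*} (E : X → Type*) where
  {base : X}
  fst : E base
  snd : E base

/-- `E * E` has the subspace topology of `E × E`. -/
instance {X : Type*} (E : X → Type*) [TopologicalSpace (Bundle.TotalSpace Unit E)] :
    TopologicalSpace (FibrePair E) :=
  TopologicalSpace.induced
    (fun p => ((⟨p.base, p.fst⟩, ⟨p.base, p.snd⟩) :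
      Bundle.TotalSpace Unit E × Bundle.TotalSpace Unit E)) inferInstance

/-- A (continuous, real) Hilbert bundle over `X` in the sense of Fell and Doran. The total space is
`Bundle.TotalSpace Unit fibre`, whose points are the pairs `⟨x, v⟩` with `v` in the fibre at `x`
(the argument `Unit` is a dummy). -/
structure HilbertBundle (X : Type*) [TopologicalSpace X] where
  fibre : X → Type*
  [normed : ∀ x, NormedAddCommGroup (fibre x)]
  [innerProduct : ∀ x, InnerProductSpace ℝ (fibre x)]
  [complete : ∀ x, CompleteSpace (fibre x)]
  [topology : TopologicalSpace (Bundle.TotalSpace Unit fibre)]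
  [hausdorff : T2Space (Bundle.TotalSpace Unit fibre)]
  continuous_proj : Continuous fun b : Bundle.TotalSpace Unit fibre => b.proj
  isOpenMap_proj : IsOpenMap fun b : Bundle.TotalSpace Unit fibre => b.proj
  continuous_norm : Continuous fun b : Bundle.TotalSpace Unit fibre => ‖b.snd‖
  continuous_add : Continuous fun p : FibrePair fibre =>
    (⟨p.base, p.fst + p.snd⟩ : Bundle.TotalSpace Unit fibre)
  continuous_smul : ∀ a : ℝ, Continuous fun b : Bundle.TotalSpace Unit fibre =>
    (⟨b.proj, a • b.snd⟩ : Bundle.TotalSpace Unit fibre)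
  /-- If `π(b) → x` and `‖b‖ → 0` along a net, then `b → 0_x`. -/
  tendsto_zero : ∀ x : X,
    comap (fun b : Bundle.TotalSpace Unit fibre => b.proj) (𝓝 x) ⊓
      comap (fun b : Bundle.TotalSpace Unit fibre => ‖b.snd‖) (𝓝 0) ≤
        𝓝 (⟨x, 0⟩ : Bundle.TotalSpace Unit fibre)

namespace HilbertBundle

variable {X : Type*} [TopologicalSpace X]

instance (E : HilbertBundle X) (x : X) : NormedAddCommGroup (E.fibre x) := E.normed x
instance (E : HilbertBundle X) (x : X) : InnerProductSpace ℝ (E.fibre x) := E.innerProduct x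
instance (E : HilbertBundle X) (x : X) : CompleteSpace (E.fibre x) := E.complete x

/-- The total space of a Hilbert bundle. -/
abbrev Total (E : HilbertBundle X) := Bundle.TotalSpace Unit E.fibre

instance (E : HilbertBundle X) : TopologicalSpace E.Total := E.topology
instance (E : HilbertBundle X) : T2Space E.Total := E.hausdorff

end HilbertBundle

/-- The set `G * E` of pairs `(γ, v)` with `γ` an arrow and `v` in the fibre at `s(γ)`. -/
structure ActionPair {X : Type*} [Groupoid X] (E : X → Type*) where
  {x : X}
  {y : X}
  arrow : x ⟶ y
  vec : E x

/-- `G * E` has the subspace topology of `G × E`. -/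
instance {X : Type*} [Groupoid X] [TopologicalSpace (Arr X)] (E : X → Type*)
    [TopologicalSpace (Bundle.TotalSpace Unit E)] : TopologicalSpace (ActionPair E) :=
  TopologicalSpace.induced
    (fun p => ((⟨p.arrow⟩, ⟨p.x, p.vec⟩) : Arr X × Bundle.TotalSpace Unit E)) inferInstance

/-- A continuous `G`-Hilbert bundle: a Hilbert bundle over the unit space with a continuous action
of `G` by linear isometries `L γ : E_{s(γ)} → E_{r(γ)}`. By the two functoriality laws each `L γ`
is bijective with inverse `L γ⁻¹`. -/
structure GHilbertBundle (X : Type*) [Groupoid X] [TopologicalSpace X]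
    [TopologicalSpace (Arr X)] extends HilbertBundle X where
  L : ∀ {x y : X}, (x ⟶ y) → (fibre x →ₗᵢ[ℝ] fibre y)
  L_id : ∀ (x : X) (v : fibre x), L (𝟙 x) v = v
  L_comp : ∀ {x y z : X} (γ' : x ⟶ y) (γ : y ⟶ z) (v : fibre x), L (γ' ≫ γ) v = L γ (L γ' v)
  continuous_action : Continuous fun p : ActionPair fibre =>
    (⟨p.y, L p.arrow p.vec⟩ : Bundle.TotalSpace Unit fibre)

/-- A continuous one-cocycle `c : G → r^*E`. -/
structure ContinuousCocycle {X : Type*} [Groupoid X] [TopologicalSpace X]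
    [TopologicalSpace (Arr X)] (E : GHilbertBundle X) where
  toFun : ∀ γ : Arr X, E.fibre γ.rng
  cocycle : ∀ {x y z : X} (γ : y ⟶ z) (γ' : x ⟶ y),
    (toFun ⟨γ' ≫ γ⟩ : E.fibre z) = toFun ⟨γ⟩ + E.L γ (toFun ⟨γ'⟩)
  continuous : Continuous fun γ : Arr X => (⟨γ.rng, toFun γ⟩ : E.Total)

/-- The pair `(E, c)` represents `ψ`: `ψ(γ) = ‖c(γ)‖²` for all `γ`, and for each unit `x` the set
`{c(γ) : γ ∈ G^x}` is total in `E_x`, i.e. its linear span is dense. -/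
structure Represents {X : Type*} [Groupoid X] [TopologicalSpace X] [TopologicalSpace (Arr X)]
    (E : GHilbertBundle X) (c : ContinuousCocycle E) (ψ : Arr X → ℝ) : Prop where
  norm_sq : ∀ γ : Arr X, ψ γ = ‖c.toFun γ‖ ^ 2
  total : ∀ x : X, Dense
    (↑(Submodule.span ℝ (Set.range fun γ : RFibre x => (c.toFun γ.toArr : E.fibre x)) :
      Submodule ℝ (E.fibre x)) : Set (E.fibre x))

/-- A continuous `G`-equivariant bundle map which is a linear isometry on each fibre. -/
structure EquivariantIsometry {X : Type*} [Groupoid X] [TopologicalSpace X]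
    [TopologicalSpace (Arr X)] (E E' : GHilbertBundle X) where
  toFun : ∀ x : X, E.fibre x →ₗᵢ[ℝ] E'.fibre x
  equivariant : ∀ {x y : X} (γ : x ⟶ y) (v : E.fibre x),
    toFun y (E.L γ v) = E'.L γ (toFun x v)
  continuous : Continuous fun b : E.Total => (⟨b.proj, toFun b.proj b.snd⟩ : E'.Total)

/-! Existence is a GNS construction carried out over each unit. Based at the unit `x`, negativity of
`ψ` says that `K(γ,γ') = (ψ(γ) + ψ(γ') - ψ(γ⁻¹γ'))/2` is of positive type on `G^x`
(`IsCNT.isPosKernel`). Its Hilbert space is `E_x`, and `c(γ)` is the canonical vector of `γ`. The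
formula `L(γ)c(γ') = c(γγ') - c(γ)` preserves inner products, because `(γα)⁻¹(γβ) = α⁻¹β`, and so
extends to an isometry.

The topology is the delicate point, since `r` need not have continuous local sections. In their
place stand the sums `∑ ζᵢ c(γᵢ)` with fixed coefficients, parametrised by tuples of arrows with a
common range. The norm of such a sum is continuous in the tuple because `ψ` is continuous. The
tuples map openly onto the unit space because `r` is open, which is what the Haar system provides
(`HaarSystem.isOpenMap_rng`). Tubes around these families generate a Fell–Doran topology
(`GeneratingFamily.toHilbertBundle`).

For uniqueness, the cocycle identity and polarization force `⟨c(γ), c(γ')⟩ = K(γ,γ')` for any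
representing pair (`Represents.inner_eq`). Two total families with the same Gram kernel are related
by a unique isometry. Continuity of the action and of this isometry is checked on the approximating
sums. -/

/-! ## Kernels of positive type and their Hilbert spaces -/

/-- A symmetric real kernel of positive type. -/
structure IsPosKernel {S : Type*} (K : S → S → ℝ) : Prop where
  symm : ∀ x y, K y x = K x y
  sum_nonneg : ∀ f : S →₀ ℝ, 0 ≤ f.sum fun x a => f.sum fun y b => a * b * K x y

theorem IsCNTKernel.sum_nonpos_fintype {S ι : Type*} [Fintype ι] {k : S → S → ℝ}
    (hk : IsCNTKernel k) (ζ : ι → ℝ) (x : ι → S) (h : ∑ i, ζ i = 0) :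
    ∑ i, ∑ j, k (x i) (x j) * ζ i * ζ j ≤ 0 := by
  have e := (Fintype.equivFin ι).symm
  have h1 := hk.sum_nonpos _ (ζ ∘ e) (x ∘ e) (by rw [← h]; exact e.sum_comp ζ)
  rw [← e.sum_comp]
  simp_rw [← e.sum_comp (fun j => k (x _) (x j) * ζ _ * ζ j)]
  exact h1

/-- Schoenberg's argument: giving `o` the weight `-∑ f` makes the total weight zero, and the
resulting negative-type sum is `-2` times the quadratic form of the new kernel. -/
theorem IsCNTKernel.isPosKernel {S : Type*} {k : S → S → ℝ} (hk : IsCNTKernel k) (o : S) :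
    IsPosKernel fun x y => (k o x + k o y - k x y) / 2 where
  symm x y := by rw [hk.symm x y]; ring
  sum_nonneg f := by
    -- Indexing by `Option` keeps the extra copy of `o` separate even when `o` lies in the support
    -- of `f`.
    let ζ : Option f.support → ℝ := fun i => i.elim (-∑ i : f.support, f i) fun i => f i
    let p : Option f.support → S := fun i => i.elim o fun i => i
    have h := hk.sum_nonpos_fintype ζ p (by simp [ζ, Fintype.sum_option])
    simp only [Fintype.sum_option, ζ, p, Option.elim, hk.diag, zero_mul, zero_add,
      fun y => hk.symm o y, Finset.sum_add_distrib] at h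
    simp only [Finsupp.sum]
    rw [← Finset.sum_coe_sort]
    simp_rw [← Finset.sum_coe_sort f.support (fun y => _ * f y * _)]
    have h1 : ∑ i : f.support, ∑ j : f.support,
          f i * f j * ((k o i + k o j - k i j) / 2) =
        (∑ i : f.support, f i) * (∑ i : f.support, k o i * f i) -
          (∑ i : f.support, ∑ j : f.support, k i j * f i * f j) / 2 := by
      have h2 : ∀ i j : f.support, f i * f j * ((k o i + k o j - k i j) / 2) =
          ((k o i * f i) * f j) / 2 + (f i * (k o j * f j)) / 2 - (k i j * f i * f j) / 2 :=
        fun i j => by ring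
      simp_rw [h2, Finset.sum_sub_distrib, Finset.sum_add_distrib, ← Finset.sum_div,
        ← Finset.mul_sum, ← Finset.sum_mul]
      ring
    have h3 : ∀ r : ℝ, ∑ x : f.support, k o x * r * f x = r * ∑ i : f.support, k o i * f i :=
      fun r => by rw [Finset.mul_sum]; exact Finset.sum_congr rfl fun i _ => by ring
    have h4 : ∀ r : ℝ, ∑ x : f.support, k o x * f x * r = r * ∑ i : f.support, k o i * f i :=
      fun r => by rw [Finset.mul_sum]; exact Finset.sum_congr rfl fun i _ => by ring
    rw [h3, h4] at h
    rw [h1]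
    linarith

namespace IsPosKernel

variable {S : Type*} {K : S → S → ℝ}

noncomputable section

/-- The semi-inner product defined by a kernel of positive type. -/
abbrev core (hK : IsPosKernel K) : PreInnerProductSpace.Core ℝ (S →₀ ℝ) where
  inner f g := f.sum fun x a => g.sum fun y b => a * b * K x y
  conj_inner_symm f g := by
    rw [Finsupp.sum_comm]
    simp only [conj_trivial]
    refine Finsupp.sum_congr fun x _ => Finsupp.sum_congr fun y _ => ?_
    rw [hK.symm, mul_comm (g y)]
  re_inner_nonneg f := by simpa using hK.sum_nonneg f
  add_left f g h := by
    rw [Finsupp.sum_add_index'] <;> simp [← Finsupp.sum_add, add_mul]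
  smul_left f g r := by
    rw [Finsupp.sum_smul_index] <;> simp [Finsupp.mul_sum, ← mul_assoc]

/-- The space of finitely supported functions, with the semi-inner product defined by a kernel. -/
def Pre (_ : IsPosKernel K) : Type _ := S →₀ ℝ

variable (hK : IsPosKernel K)

instance : AddCommGroup hK.Pre := inferInstanceAs (AddCommGroup (S →₀ ℝ))

instance : Module ℝ hK.Pre := inferInstanceAs (Module ℝ (S →₀ ℝ))

instance : SeminormedAddCommGroup hK.Pre :=
  letI : PreInnerProductSpace.Core ℝ hK.Pre := hK.core
  InnerProductSpace.Core.toSeminormedAddCommGroup (𝕜 := ℝ)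

instance : InnerProductSpace ℝ hK.Pre :=
  letI : PreInnerProductSpace.Core ℝ hK.Pre := hK.core
  .ofCore _

/-- The Hilbert space of a kernel of positive type. -/
abbrev Space := UniformSpace.Completion hK.Pre

/-- The canonical map to the Hilbert space of a kernel of positive type. -/
def feature (x : S) : hK.Space := 
  UniformSpace.Completion.coe' (α := hK.Pre) (Finsupp.single x 1 : S →₀ ℝ)

theorem inner_feature (x y : S) : inner ℝ (hK.feature x) (hK.feature y) = K x y := by
  refine (UniformSpace.Completion.inner_coe (E := hK.Pre) _ _).trans ?_
  change (Finsupp.sum (Finsupp.single x (1 : ℝ)) fun x a =>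
    Finsupp.sum (Finsupp.single y (1 : ℝ)) fun y b => a * b * K x y) = _
  simp

theorem dense_span_feature :
    Dense (Submodule.span ℝ (Set.range hK.feature) : Set hK.Space) := by
  have h : DenseRange ((↑) : hK.Pre → hK.Space) := UniformSpace.Completion.denseRange_coe
  refine h.mono ?_
  rintro _ ⟨f, rfl⟩
  let φ : (S →₀ ℝ) →ₗ[ℝ] hK.Space :=
    (UniformSpace.Completion.toComplₗᵢ (𝕜 := ℝ) (E := hK.Pre)).toLinearMap
  have h2 : φ = Finsupp.linearCombination ℝ hK.feature := by
    ext x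
    simp only [Finsupp.linearCombination_single, LinearMap.comp_apply, Finsupp.lsingle_apply,
      one_smul]
    rfl
  have h3 : φ f ∈ Submodule.span ℝ (Set.range hK.feature) := by
    rw [h2, ← Finsupp.range_linearCombination]
    exact ⟨f, rfl⟩
  exact h3

end

end IsPosKernel

/-! ## Isometries defined on a total set -/

section Isometry

variable {S F F' : Type*} [NormedAddCommGroup F] [InnerProductSpace ℝ F]
  [NormedAddCommGroup F'] [InnerProductSpace ℝ F']

theorem norm_linearCombination_sq (a : S → F) (f : S →₀ ℝ) :
    ‖Finsupp.linearCombination ℝ a f‖ ^ 2 =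
      f.sum fun i r => f.sum fun j t => r * t * inner ℝ (a i) (a j) := by
  rw [← real_inner_self_eq_norm_sq, Finsupp.linearCombination_apply, Finsupp.sum_inner]
  simp [Finsupp.inner_sum, inner_smul_left, inner_smul_right, mul_assoc,
    mul_left_comm]

/-- Equal Gram matrices give corresponding linear combinations equal norms, so sending one
combination to the other is well defined and isometric on a dense subspace. -/
theorem exists_linearIsometry_of_inner_eq [CompleteSpace F'] {a : S → F} {b : S → F'}
    (ha : Dense (Submodule.span ℝ (Set.range a) : Set F))
    (h : ∀ i j, inner ℝ (a i) (a j) = inner ℝ (b i) (b j)) :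
    ∃ u : F →ₗᵢ[ℝ] F', ∀ i, u (a i) = b i := by
  have hnorm : ∀ f : S →₀ ℝ,
      ‖Finsupp.linearCombination ℝ b f‖ = ‖Finsupp.linearCombination ℝ a f‖ := fun f => by
    rw [← sq_eq_sq₀ (norm_nonneg _) (norm_nonneg _), norm_linearCombination_sq,
      norm_linearCombination_sq]
    simp_rw [h]
  have hd : DenseRange (Finsupp.linearCombination ℝ a) := by
    rwa [DenseRange, ← LinearMap.coe_range, Finsupp.range_linearCombination]
  have hb : ∃ C, ∀ f : S →₀ ℝ,
      ‖Finsupp.linearCombination ℝ b f‖ ≤ C * ‖Finsupp.linearCombination ℝ a f‖ :=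
    ⟨1, fun f => by rw [one_mul, hnorm]⟩
  let φ := (Finsupp.linearCombination ℝ b).extendOfNorm (Finsupp.linearCombination ℝ a)
  have hφ : ∀ f, φ (Finsupp.linearCombination ℝ a f) = Finsupp.linearCombination ℝ b f :=
    LinearMap.extendOfNorm_eq hd hb
  refine ⟨⟨φ.toLinearMap, fun v => ?_⟩, fun i => ?_⟩
  · refine hd.induction_on (p := fun v => ‖φ v‖ = ‖v‖) v
      (isClosed_eq (by fun_prop) (by fun_prop)) fun f => ?_
    rw [hφ, hnorm]
  · simpa using hφ (Finsupp.single i 1)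

theorem LinearIsometry.ext_of_dense_span {a : S → F}
    (ha : Dense (Submodule.span ℝ (Set.range a) : Set F)) {u u' : F →ₗᵢ[ℝ] F'}
    (h : ∀ i, u (a i) = u' (a i)) (v : F) : u v = u' v := by
  have := ContinuousLinearMap.ext_on (f := u.toContinuousLinearMap)
    (g := u'.toContinuousLinearMap) ha (by rintro _ ⟨i, rfl⟩; exact h i)
  exact DFunLike.congr_fun this v

end Isometry

/-! ## Fibred products -/

/-- The fibred product of two families over the same base. -/
structure FibreProd {X : Type*} (T T' : X → Type*) where
  {base : X}
  fst : T base
  snd : T' base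

namespace FibreProd

variable {X : Type*} {T T' : X → Type*}

/-- The first projection of a fibred product. -/
def left (q : FibreProd T T') : Bundle.TotalSpace Unit T := ⟨q.base, q.fst⟩

/-- The second projection of a fibred product. -/
def right (q : FibreProd T T') : Bundle.TotalSpace Unit T' := ⟨q.base, q.snd⟩

variable [TopologicalSpace (Bundle.TotalSpace Unit T)] [TopologicalSpace (Bundle.TotalSpace Unit T')]

instance : TopologicalSpace (FibreProd T T') :=
  TopologicalSpace.induced (fun q => (q.left, q.right)) inferInstance

theorem nhds_eq (q : FibreProd T T') :
    𝓝 q = comap (fun q => (q.left, q.right)) (𝓝 q.left ×ˢ 𝓝 q.right) := by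
  rw [nhds_induced, nhds_prod_eq]

theorem continuous_left : Continuous (left : FibreProd T T' → _) :=
  (continuous_induced_dom (f := fun q : FibreProd T T' => (q.left, q.right))).fst

theorem continuous_right : Continuous (right : FibreProd T T' → _) :=
  (continuous_induced_dom (f := fun q : FibreProd T T' => (q.left, q.right))).snd

theorem exists_of_mem_nhds {x : X} {t : T x} {t' : T' x} {A : Set (FibreProd T T')}
    (hA : A ∈ 𝓝 (⟨t, t'⟩ : FibreProd T T')) :
    ∃ V ∈ 𝓝 (⟨x, t⟩ : Bundle.TotalSpace Unit T), ∃ V' ∈ 𝓝 (⟨x, t'⟩ : Bundle.TotalSpace Unit T'),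
      ∀ (y : X) (s : T y) (s' : T' y), (⟨y, s⟩ : Bundle.TotalSpace Unit T) ∈ V →
        (⟨y, s'⟩ : Bundle.TotalSpace Unit T') ∈ V' → (⟨s, s'⟩ : FibreProd T T') ∈ A := by
  rw [nhds_eq, mem_comap] at hA
  obtain ⟨B, hB, hBA⟩ := hA
  obtain ⟨V, hV, V', hV', h⟩ := mem_prod_iff.1 hB
  exact ⟨V, hV, V', hV', fun y s s' hs hs' => hBA (h ⟨hs, hs'⟩)⟩

end FibreProd

/-! ## Convergence in Hilbert bundles -/

namespace HilbertBundle

variable {X : Type*} [TopologicalSpace X] (E : HilbertBundle X)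

section Tendsto

variable {Z : Type*} {l : Filter Z} {p : Z → X} {f g : ∀ z, E.fibre (p z)} {x : X}
  {v w : E.fibre x}

theorem tendsto_add (hf : Tendsto (fun z => (⟨p z, f z⟩ : E.Total)) l (𝓝 ⟨x, v⟩))
    (hg : Tendsto (fun z => (⟨p z, g z⟩ : E.Total)) l (𝓝 ⟨x, w⟩)) :
    Tendsto (fun z => (⟨p z, f z + g z⟩ : E.Total)) l (𝓝 ⟨x, v + w⟩) := by
  have h : Tendsto (fun z => (⟨f z, g z⟩ : FibrePair E.fibre)) l (𝓝 ⟨v, w⟩) := by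
    rw [nhds_induced, tendsto_comap_iff]
    exact hf.prodMk_nhds hg
  exact (E.continuous_add.tendsto _).comp h

theorem tendsto_smul (a : ℝ) (hf : Tendsto (fun z => (⟨p z, f z⟩ : E.Total)) l (𝓝 ⟨x, v⟩)) :
    Tendsto (fun z => (⟨p z, a • f z⟩ : E.Total)) l (𝓝 ⟨x, a • v⟩) :=
  ((E.continuous_smul a).tendsto (⟨x, v⟩ : E.Total)).comp hf

theorem tendsto_zero_section (hp : Tendsto p l (𝓝 x)) :
    Tendsto (fun z => (⟨p z, 0⟩ : E.Total)) l (𝓝 ⟨x, 0⟩) := by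
  refine Tendsto.mono_right ?_ (E.tendsto_zero x)
  rw [tendsto_inf, tendsto_comap_iff, tendsto_comap_iff]
  refine ⟨hp, ?_⟩
  simpa [Function.comp_def] using tendsto_const_nhds

theorem tendsto_sum {ι : Type*} (s : Finset ι) {F : ι → ∀ z, E.fibre (p z)}
    {V : ι → E.fibre x} (hp : Tendsto p l (𝓝 x))
    (h : ∀ i ∈ s, Tendsto (fun z => (⟨p z, F i z⟩ : E.Total)) l (𝓝 ⟨x, V i⟩)) :
    Tendsto (fun z => (⟨p z, ∑ i ∈ s, F i z⟩ : E.Total)) l (𝓝 ⟨x, ∑ i ∈ s, V i⟩) := by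
  classical
  induction s using Finset.induction_on with
  | empty => simpa using E.tendsto_zero_section hp
  | insert i s hi ih =>
    simp only [Finset.sum_insert hi]
    exact E.tendsto_add (h i (Finset.mem_insert_self i s))
      (ih fun j hj => h j (Finset.mem_insert_of_mem hj))

/-- Continuity of addition at `(v, 0)`, with the last Fell–Doran axiom describing the neighbourhoods
of `0_x` by a base neighbourhood and a norm bound. -/
theorem exists_add_mem_nhds {O : Set E.Total} (hO : O ∈ 𝓝 (⟨x, v⟩ : E.Total)) :
    ∃ O₁ ∈ 𝓝 (⟨x, v⟩ : E.Total), ∃ U ∈ 𝓝 x, ∃ ε > 0, ∀ y ∈ U, ∀ b d : E.fibre y,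
      (⟨y, b⟩ : E.Total) ∈ O₁ → ‖d‖ < ε → (⟨y, b + d⟩ : E.Total) ∈ O := by
  have h : O ∈ 𝓝 (⟨x, v + 0⟩ : E.Total) := by rwa [add_zero]
  have h1 := E.continuous_add.continuousAt (x := ⟨v, 0⟩) h
  rw [mem_map, nhds_induced, nhds_prod_eq, mem_comap] at h1
  obtain ⟨B, hB, hBO⟩ := h1
  obtain ⟨O₁, hO₁, N, hN, hON⟩ := mem_prod_iff.1 hB
  obtain ⟨A₁, ⟨U, hU, hUA⟩, A₂, ⟨D, hD, hDA⟩, rfl⟩ := mem_inf_iff.1 (E.tendsto_zero x hN)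
  obtain ⟨ε, hε, hεD⟩ := Metric.mem_nhds_iff.1 hD
  refine ⟨O₁, hO₁, U, hU, ε, hε, fun y hy b d hb hd => ?_⟩
  have hd' : (⟨y, d⟩ : E.Total) ∈ A₁ ∩ A₂ :=
    ⟨hUA hy, hDA (hεD (by simpa using hd))⟩
  have hm : (((⟨y, b⟩, ⟨y, d⟩) : E.Total × E.Total)) ∈ B := hON ⟨hb, hd'⟩
  exact hBO (a := ⟨b, d⟩) hm

/-- A convergence test up to small norm errors: it reduces continuity of a map to its continuity
along approximating families. -/
theorem tendsto_of_approx (hp : Tendsto p l (𝓝 x))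
    (h : ∀ ε > 0, ∃ w : E.fibre x, ‖v - w‖ < ε ∧ ∀ O ∈ 𝓝 (⟨x, w⟩ : E.Total),
      ∀ᶠ z in l, ∃ w' : E.fibre (p z), (⟨p z, w'⟩ : E.Total) ∈ O ∧ ‖f z - w'‖ < ε) :
    Tendsto (fun z => (⟨p z, f z⟩ : E.Total)) l (𝓝 ⟨x, v⟩) := by
  intro O hO
  obtain ⟨O₁, hO₁, U, hU, ε, hε, hadd⟩ := E.exists_add_mem_nhds hO
  -- This second radius is fixed before `w` is chosen; it ensures that `w = v + (w - v)` lies in the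
  -- interior of `O₁`.
  obtain ⟨O₂, hO₂, U₂, hU₂, ε₂, hε₂, hadd₂⟩ :=
    E.exists_add_mem_nhds (interior_mem_nhds.2 hO₁)
  obtain ⟨w, hw, hev⟩ := h (min ε ε₂) (lt_min hε hε₂)
  have hw₁ : (⟨x, w⟩ : E.Total) ∈ interior O₁ := by
    have := hadd₂ x (mem_of_mem_nhds hU₂) v (w - v) (mem_of_mem_nhds hO₂)
      (by rw [norm_sub_rev]; exact hw.trans_le (min_le_right _ _))
    rwa [add_sub_cancel] at this
  change ∀ᶠ z in l, (⟨p z, f z⟩ : E.Total) ∈ O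
  filter_upwards [hev O₁ (mem_interior_iff_mem_nhds.1 hw₁), hp.eventually_mem hU] with z ⟨w', hw', hd⟩ hz
  have := hadd (p z) hz w' (f z - w') hw' (hd.trans_le (min_le_left _ _))
  rwa [add_sub_cancel] at this

end Tendsto

theorem continuous_sum {Z ι : Type*} [TopologicalSpace Z] [Fintype ι] {p : Z → X}
    (hp : Continuous p) (ζ : ι → ℝ) {F : ι → ∀ z, E.fibre (p z)}
    (h : ∀ i, Continuous fun z => (⟨p z, F i z⟩ : E.Total)) :
    Continuous fun z => (⟨p z, ∑ i, ζ i • F i z⟩ : E.Total) :=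
  continuous_iff_continuousAt.2 fun z =>
    E.tendsto_sum _ hp.continuousAt fun i _ => E.tendsto_smul (ζ i) (h i).continuousAt

/-- The distance from `b` to `Φ t` is continuous on the fibred product, and openness of the
projection of `T` supplies a parameter near `t` over every base point near `x`. -/
theorem eventually_exists_norm_sub_lt {T : X → Type*} [TopologicalSpace (Bundle.TotalSpace Unit T)]
    (hT : IsOpenMap fun t : Bundle.TotalSpace Unit T => t.proj) {Φ : ∀ x, T x → E.fibre x}
    (hΦ : Continuous fun t : Bundle.TotalSpace Unit T => (⟨t.proj, Φ t.proj t.snd⟩ : E.Total))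
    {x : X} {v : E.fibre x} {t : T x} {ε : ℝ} (hv : ‖v - Φ x t‖ < ε)
    {V : Set (Bundle.TotalSpace Unit T)} (hV : V ∈ 𝓝 (⟨x, t⟩ : Bundle.TotalSpace Unit T)) :
    ∀ᶠ b : E.Total in 𝓝 ⟨x, v⟩, ∃ t' : T b.proj,
      (⟨b.proj, t'⟩ : Bundle.TotalSpace Unit T) ∈ V ∧ ‖b.snd - Φ b.proj t'‖ < ε := by
  have h1 : Tendsto (fun q : FibreProd E.fibre T => (⟨q.base, q.fst + (-1 : ℝ) • Φ q.base q.snd⟩ :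
      E.Total)) (𝓝 ⟨v, t⟩) (𝓝 ⟨x, v + (-1 : ℝ) • Φ x t⟩) :=
    E.tendsto_add (FibreProd.continuous_left.tendsto (⟨v, t⟩ : FibreProd E.fibre T))
      (E.tendsto_smul (-1)
        ((hΦ.comp FibreProd.continuous_right).tendsto (⟨v, t⟩ : FibreProd E.fibre T)))
  have h2 := (E.continuous_norm.tendsto _).comp h1
  have h3 : ∀ᶠ q : FibreProd E.fibre T in 𝓝 ⟨v, t⟩, ‖q.fst - Φ q.base q.snd‖ < ε := by
    have := h2.eventually_lt_const (u := ε) (by simpa [← sub_eq_add_neg] using hv)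
    simpa [← sub_eq_add_neg] using this
  obtain ⟨N, hN, V', hV', h⟩ := FibreProd.exists_of_mem_nhds h3
  filter_upwards [hN, E.continuous_proj.continuousAt (hT.image_mem_nhds (inter_mem hV hV'))]
    with b hb hbV
  obtain ⟨⟨y, t'⟩, ⟨ht, ht'⟩, hy⟩ := hbV
  obtain ⟨z, b⟩ := b
  obtain rfl : y = z := hy
  exact ⟨t', ht, h y b t' hb ht'⟩

end HilbertBundle

/-! ## The range map of a groupoid with a Haar system -/

section Range

variable {X : Type*} [Groupoid X]

theorem RFibre.toArr_injective (x : X) : Function.Injective (RFibre.toArr (x := x)) := by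
  rintro ⟨f⟩ ⟨g⟩ h
  cases h
  rfl

theorem RFibre.range_toArr (x : X) : Set.range (RFibre.toArr (x := x)) = {γ | γ.rng = x} := by
  ext γ
  constructor
  · rintro ⟨γ, rfl⟩
    rfl
  · rintro rfl
    exact ⟨⟨γ.hom⟩, rfl⟩

variable [TopologicalSpace X] [TopologicalSpace (Arr X)] [IsTopologicalGroupoid X]

theorem IsTopologicalGroupoid.t2Space_unit [T2Space (Arr X)] : T2Space X :=
  T2Space.of_injective_continuous (f := fun x : X => (⟨𝟙 x⟩ : Arr X))
    (fun _ _ h => congrArg Arr.src h) continuous_unit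

theorem RFibre.isClosedEmbedding_toArr [T2Space (Arr X)] (x : X) :
    IsClosedEmbedding (RFibre.toArr (x := x)) := by
  have : T2Space X := IsTopologicalGroupoid.t2Space_unit
  refine ⟨⟨⟨rfl⟩, RFibre.toArr_injective x⟩, ?_⟩
  rw [RFibre.range_toArr]
  exact isClosed_singleton.preimage IsTopologicalGroupoid.continuous_rng

/-- A nonnegative bump function supported in `U` and equal to `1` at `γ` has positive integral over
`G^{r(γ)}` by full support. Continuity of the integral keeps it positive over nearby units, whose
fibres must therefore meet `U`. -/
theorem HaarSystem.isOpenMap_rng [LocallyCompactSpace (Arr X)] [T2Space (Arr X)]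
    (lam : HaarSystem X) : IsOpenMap fun γ : Arr X => γ.rng := by
  intro U hU
  rw [isOpen_iff_mem_nhds]
  rintro _ ⟨γ, hγ, rfl⟩
  obtain ⟨f, hf₁, hf₀, hfc, hf⟩ := exists_continuous_one_zero_of_isCompact
    (isCompact_singleton (x := γ)) hU.isClosed_compl (by simpa using hγ)
  have hreg := lam.regular γ.rng
  have hsupp := lam.full_support γ.rng
  have hpos : 0 < ∫ γ', f γ'.toArr ∂(lam.lam γ.rng) := by
    have he := RFibre.isClosedEmbedding_toArr (X := X) γ.rng
    refine (f.continuous.comp he.continuous).integral_pos_of_hasCompactSupport_nonneg_nonzero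
      (x := ⟨γ.hom⟩) (hfc.comp_isClosedEmbedding he) (fun γ' => (hf _).1) ?_
    change f γ ≠ 0
    rw [hf₁ rfl]
    exact one_ne_zero
  have hcont := lam.continuous_integral f f.continuous hfc
  filter_upwards [hcont.continuousAt.eventually_const_lt hpos] with x hx
  by_contra hxU
  refine hx.ne' (integral_eq_zero_of_ae (Eventually.of_forall fun γ' => hf₀ fun h => hxU ?_))
  exact ⟨γ'.toArr, h, rfl⟩

end Range

/-! ## Tuples of arrows with the same range -/

/-- The tuples of arrows with range `x`. -/
def RFibreTuple {X : Type*} [Groupoid X] (ι : Type*) (x : X) := ι → RFibre x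

namespace RFibreTuple

variable {X : Type*} [Groupoid X] [TopologicalSpace X] [TopologicalSpace (Arr X)] {ι : Type*}

instance : TopologicalSpace (Bundle.TotalSpace Unit (RFibreTuple (X := X) ι)) :=
  TopologicalSpace.induced
    (fun t => ((t.proj, fun i => (t.snd i).toArr) : X × (ι → Arr X))) inferInstance

theorem continuous_coe : Continuous fun t : Bundle.TotalSpace Unit (RFibreTuple (X := X) ι) =>
    ((t.proj, fun i => (t.snd i).toArr) : X × (ι → Arr X)) := continuous_induced_dom

theorem continuous_proj :
    Continuous fun t : Bundle.TotalSpace Unit (RFibreTuple (X := X) ι) => t.proj :=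
  continuous_coe.fst

theorem continuous_apply (i : ι) :
    Continuous fun t : Bundle.TotalSpace Unit (RFibreTuple (X := X) ι) => (t.snd i).toArr :=
  (_root_.continuous_apply i).comp continuous_coe.snd

theorem isOpenMap_proj [Finite ι] (hr : IsOpenMap fun γ : Arr X => γ.rng) :
    IsOpenMap fun t : Bundle.TotalSpace Unit (RFibreTuple (X := X) ι) => t.proj := by
  rw [isOpenMap_iff_nhds_le]
  rintro ⟨x, t⟩ A hA
  rw [mem_map, nhds_induced, mem_comap, nhds_prod_eq, nhds_pi] at hA
  obtain ⟨B, hB, hBA⟩ := hA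
  obtain ⟨W, hW, P, hP, hWP⟩ := mem_prod_iff.1 hB
  obtain ⟨I, -, U, hU, hUP⟩ := mem_pi.1 hP
  have h : ∀ i, (fun γ : Arr X => γ.rng) '' U i ∈ 𝓝 x := fun i => hr.image_mem_nhds (hU i)
  filter_upwards [hW, iInter_mem.2 h] with y hyW hy
  have h2 : ∀ i, ∃ γ : RFibre y, γ.toArr ∈ U i := fun i => by
    obtain ⟨γ, hγ, rfl⟩ := Set.mem_iInter.1 hy i
    exact ⟨⟨γ.hom⟩, hγ⟩
  choose γ hγ using h2
  exact hBA (a := (⟨y, γ⟩ : Bundle.TotalSpace Unit (RFibreTuple ι)))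
    (hWP ⟨hyW, hUP fun i _ => hγ i⟩)

end RFibreTuple

/-! ## Hilbert bundles generated by continuous families -/

section Generating

variable {X : Type*} [TopologicalSpace X]

/-- Spaces `T s` over `X` with maps from their fibres to the fibres of a field of Hilbert spaces
`H`, whose values are dense in each fibre. These data determine a topology on the total space. -/
structure GeneratingFamily (H : X → Type*) [∀ x, NormedAddCommGroup (H x)]
    [∀ x, InnerProductSpace ℝ (H x)] where
  σ : Type*
  T : σ → X → Type*
  [topology : ∀ s, TopologicalSpace (Bundle.TotalSpace Unit (T s))]
  Φ : ∀ {s x}, T s x → H x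
  continuous_proj : ∀ s, Continuous fun t : Bundle.TotalSpace Unit (T s) => t.proj
  isOpenMap_proj : ∀ s, IsOpenMap fun t : Bundle.TotalSpace Unit (T s) => t.proj
  continuous_norm : ∀ s, Continuous fun t : Bundle.TotalSpace Unit (T s) => ‖Φ t.snd‖
  exists_linear_comb : ∀ (a b : ℝ) (s s' : σ), ∃ (s'' : σ) (m : ∀ x, T s x → T s' x → T s'' x),
    (Continuous fun q : FibreProd (T s) (T s') =>
      (⟨q.base, m _ q.fst q.snd⟩ : Bundle.TotalSpace Unit (T s''))) ∧
      ∀ x t t', Φ (m x t t') = a • Φ t + b • Φ t'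
  exists_norm_sub_lt : ∀ x (v : H x), ∀ ε > 0, ∃ (s : σ) (t : T s x), ‖v - Φ t‖ < ε

namespace GeneratingFamily

variable {H : X → Type*} [∀ x, NormedAddCommGroup (H x)] [∀ x, InnerProductSpace ℝ (H x)]
  (F : GeneratingFamily H)

instance (s : F.σ) : TopologicalSpace (Bundle.TotalSpace Unit (F.T s)) := F.topology s

/-- The vectors within distance `ε` of the values of the family `s` on `V`. -/
def tube (s : F.σ) (V : Set (Bundle.TotalSpace Unit (F.T s))) (ε : ℝ) :
    Set (Bundle.TotalSpace Unit H) :=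
  {b | ∃ t : F.T s b.proj, (⟨b.proj, t⟩ : Bundle.TotalSpace Unit (F.T s)) ∈ V ∧
    ‖b.snd - F.Φ t‖ < ε}

/-- The topology generated by the tubes around open sets. -/
abbrev totalTopology : TopologicalSpace (Bundle.TotalSpace Unit H) :=
  TopologicalSpace.generateFrom {W | ∃ s V ε, IsOpen V ∧ W = F.tube s V ε}

theorem tube_mono {s : F.σ} {V V' : Set (Bundle.TotalSpace Unit (F.T s))} {ε ε' : ℝ}
    (hV : V ⊆ V') (hε : ε ≤ ε') : F.tube s V ε ⊆ F.tube s V' ε' :=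
  fun _ ⟨t, ht, h⟩ => ⟨t, hV ht, h.trans_le hε⟩

theorem continuous_norm_sub (s s' : F.σ) :
    Continuous fun q : FibreProd (F.T s) (F.T s') => ‖F.Φ q.fst - F.Φ q.snd‖ := by
  obtain ⟨s'', m, hm, h⟩ := F.exists_linear_comb 1 (-1) s s'
  have := (F.continuous_norm s'').comp hm
  simpa [Function.comp_def, h, ← sub_eq_add_neg] using this

/-- Any good enough approximant of `v`, from any family, gives a tube inside the given one; hence
tubes around a single approximant suffice to describe neighbourhoods. -/
theorem exists_tube_subset_tube {s' : F.σ} {V' : Set (Bundle.TotalSpace Unit (F.T s'))} {ε : ℝ}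
    (hV' : IsOpen V') {x : X} {v : H x}
    (hv : (⟨x, v⟩ : Bundle.TotalSpace Unit H) ∈ F.tube s' V' ε) :
    ∃ δ > 0, ∀ (s : F.σ) (t : F.T s x), ‖v - F.Φ t‖ < δ →
      ∃ V ∈ 𝓝 (⟨x, t⟩ : Bundle.TotalSpace Unit (F.T s)), F.tube s V δ ⊆ F.tube s' V' ε := by
  obtain ⟨t', ht', hlt⟩ := hv
  change ‖v - F.Φ t'‖ < ε at hlt
  -- With `δ` half the slack, `‖Φ t - Φ t'‖ < δ + (ε - 2δ) = ε - δ`. This persists near `(t, t')`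
  -- and leaves `δ` for the distance to `b`.
  refine ⟨(ε - ‖v - F.Φ t'‖) / 2, half_pos (sub_pos.2 hlt), fun s t ht => ?_⟩
  have h1 : ‖F.Φ t - F.Φ t'‖ < ε - (ε - ‖v - F.Φ t'‖) / 2 := by
    have := norm_sub_le_norm_sub_add_norm_sub (F.Φ t) v (F.Φ t')
    rw [norm_sub_rev (F.Φ t) v] at this
    linarith
  obtain ⟨V, hV, V'', hV'', h⟩ := FibreProd.exists_of_mem_nhds
    (((F.continuous_norm_sub s s').tendsto ⟨t, t'⟩).eventually_lt_const h1)
  have h2 := (F.isOpenMap_proj s').image_mem_nhds (inter_mem hV'' (hV'.mem_nhds ht'))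
  refine ⟨_, inter_mem hV ((F.continuous_proj s).continuousAt h2), ?_⟩
  rintro ⟨y, b⟩ ⟨t₁, ⟨ht₁, ⟨⟨y', t₂⟩, ⟨ht₂, ht₂'⟩, hy⟩⟩, hb⟩
  obtain rfl : y' = y := hy
  refine ⟨t₂, ht₂', ?_⟩
  have h3 : ‖F.Φ t₁ - F.Φ t₂‖ < ε - (ε - ‖v - F.Φ t'‖) / 2 := h y' t₁ t₂ ht₁ ht₂
  change ‖b - F.Φ t₁‖ < _ at hb
  change ‖b - F.Φ t₂‖ < _
  have := norm_sub_le_norm_sub_add_norm_sub b (F.Φ t₁) (F.Φ t₂)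
  linarith

/-- Asking for one `δ` that serves all approximants makes the right-hand side stable under finite
intersections, so one direction need only be checked on generating tubes. The other direction uses a
single approximant, which exists by density. -/
theorem mem_nhds_iff {x : X} {v : H x} {O : Set (Bundle.TotalSpace Unit H)} :
    O ∈ @nhds _ F.totalTopology ⟨x, v⟩ ↔ ∃ δ > 0, ∀ (s : F.σ) (t : F.T s x), ‖v - F.Φ t‖ < δ →
      ∃ V ∈ 𝓝 (⟨x, t⟩ : Bundle.TotalSpace Unit (F.T s)), F.tube s V δ ⊆ O := by
  constructor
  · let L : Filter (Bundle.TotalSpace Unit H) :=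
      { sets := {O | ∃ δ > 0, ∀ (s : F.σ) (t : F.T s x), ‖v - F.Φ t‖ < δ →
          ∃ V ∈ 𝓝 (⟨x, t⟩ : Bundle.TotalSpace Unit (F.T s)), F.tube s V δ ⊆ O}
        univ_sets := ⟨1, one_pos, fun s t _ => ⟨_, univ_mem, Set.subset_univ _⟩⟩
        sets_of_superset := fun ⟨δ, hδ, h⟩ hO => ⟨δ, hδ, fun s t ht =>
          (h s t ht).imp fun V hV => ⟨hV.1, hV.2.trans hO⟩⟩
        inter_sets := fun ⟨δ, hδ, h⟩ ⟨δ', hδ', h'⟩ => ⟨min δ δ', lt_min hδ hδ', fun s t ht => by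
          obtain ⟨V, hV, hVO⟩ := h s t (ht.trans_le (min_le_left _ _))
          obtain ⟨V', hV', hVO'⟩ := h' s t (ht.trans_le (min_le_right _ _))
          exact ⟨V ∩ V', inter_mem hV hV', Set.subset_inter
            ((F.tube_mono Set.inter_subset_left (min_le_left _ _)).trans hVO)
            ((F.tube_mono Set.inter_subset_right (min_le_right _ _)).trans hVO')⟩⟩ }
    have h : L ≤ @nhds _ F.totalTopology ⟨x, v⟩ := by
      rw [totalTopology, TopologicalSpace.nhds_generateFrom]
      refine le_iInf₂ fun W hW => le_principal_iff.2 ?_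
      obtain ⟨hv, s, V, ε, hV, rfl⟩ := hW
      exact F.exists_tube_subset_tube hV hv
    exact fun hO => h hO
  · rintro ⟨δ, hδ, h⟩
    obtain ⟨s, t, ht⟩ := F.exists_norm_sub_lt x v δ hδ
    obtain ⟨V, hV, hVO⟩ := h s t ht
    let _ := F.totalTopology
    have ho : IsOpen (F.tube s (interior V) δ) :=
      TopologicalSpace.isOpen_generateFrom_of_mem ⟨s, _, δ, isOpen_interior, rfl⟩
    exact mem_of_superset (ho.mem_nhds ⟨t, mem_interior_iff_mem_nhds.2 hV, ht⟩)
      ((F.tube_mono interior_subset le_rfl).trans hVO)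

theorem tube_mem_nhds {x : X} {v : H x} {s : F.σ} {t : F.T s x} {ε : ℝ} (h : ‖v - F.Φ t‖ < ε)
    {V : Set (Bundle.TotalSpace Unit (F.T s))}
    (hV : V ∈ 𝓝 (⟨x, t⟩ : Bundle.TotalSpace Unit (F.T s))) :
    F.tube s V ε ∈ @nhds _ F.totalTopology ⟨x, v⟩ := by
  let _ := F.totalTopology
  have ho : IsOpen (F.tube s (interior V) ε) :=
    TopologicalSpace.isOpen_generateFrom_of_mem ⟨s, _, ε, isOpen_interior, rfl⟩
  exact mem_of_superset (ho.mem_nhds ⟨t, mem_interior_iff_mem_nhds.2 hV, h⟩)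
    (F.tube_mono interior_subset le_rfl)

theorem continuous_Φ (s : F.σ) :
    Continuous[F.topology s, F.totalTopology] 
      fun t : Bundle.TotalSpace Unit (F.T s) => (⟨t.proj, F.Φ t.snd⟩ : Bundle.TotalSpace Unit H) := by
  let _ := F.totalTopology
  refine continuous_iff_continuousAt.2 fun t O hO => ?_
  obtain ⟨δ, hδ, h⟩ := F.mem_nhds_iff.1 hO
  obtain ⟨V, hV, hVO⟩ := h s t.snd (by simpa using hδ)
  exact mem_map.2 <| mem_of_superset hV fun t' ht' =>
    hVO (a := ⟨t'.proj, F.Φ t'.snd⟩) ⟨t'.snd, ht', by simpa using hδ⟩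

theorem continuous_total_proj :
    Continuous[F.totalTopology, _] (fun b : Bundle.TotalSpace Unit H => b.proj) := by
  let _ := F.totalTopology
  refine continuous_iff_continuousAt.2 fun b W hW => ?_
  refine F.mem_nhds_iff.2 ⟨1, one_pos, fun s t _ => ⟨_, (F.continuous_proj s).continuousAt hW, ?_⟩⟩
  rintro b ⟨t, ht, -⟩
  exact ht

theorem isOpenMap_total_proj :
    @IsOpenMap _ _ F.totalTopology _ (fun b : Bundle.TotalSpace Unit H => b.proj) := by
  let _ := F.totalTopology
  refine isOpenMap_iff_nhds_le.2 fun b O hO => ?_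
  obtain ⟨δ, hδ, h⟩ := F.mem_nhds_iff.1 (mem_map.1 hO)
  obtain ⟨s, t, ht⟩ := F.exists_norm_sub_lt _ b.snd δ hδ
  obtain ⟨V, hV, hVO⟩ := h s t ht
  refine mem_of_superset ((F.isOpenMap_proj s).image_mem_nhds hV) ?_
  rintro _ ⟨t', ht', rfl⟩
  exact hVO (a := ⟨t'.proj, F.Φ t'.snd⟩) ⟨t'.snd, ht', by simpa using hδ⟩

theorem continuous_total_norm :
    Continuous[F.totalTopology, _] (fun b : Bundle.TotalSpace Unit H => ‖b.snd‖) := by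
  let _ := F.totalTopology
  refine continuous_iff_continuousAt.2 fun b => Metric.tendsto_nhds.2 fun ε hε => ?_
  obtain ⟨s, t, ht⟩ := F.exists_norm_sub_lt _ b.snd (ε / 3) (by positivity)
  have hV := Metric.tendsto_nhds.1 ((F.continuous_norm s).tendsto ⟨b.proj, t⟩) (ε / 3)
    (by positivity)
  filter_upwards [F.tube_mem_nhds ht hV] with b' ⟨t', ht', hb'⟩
  have h1 : |‖F.Φ t'‖ - ‖F.Φ t‖| < ε / 3 := ht'
  have h2 := abs_lt.1 ((abs_norm_sub_norm_le _ _).trans_lt ht)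
  have h3 := abs_lt.1 ((abs_norm_sub_norm_le _ _).trans_lt hb')
  have h4 := abs_lt.1 h1
  rw [Real.dist_eq, abs_lt]
  constructor <;> linarith [h2.1, h2.2, h3.1, h3.2, h4.1, h4.2]

theorem tendsto_linear_comb (a b : ℝ) {Z : Type*} {l : Filter Z} {p : Z → X}
    {f g : ∀ z, H (p z)} {x : X} {v w : H x}
    (hf : Tendsto (fun z => (⟨p z, f z⟩ : Bundle.TotalSpace Unit H)) l
      (@nhds _ F.totalTopology ⟨x, v⟩))
    (hg : Tendsto (fun z => (⟨p z, g z⟩ : Bundle.TotalSpace Unit H)) l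
      (@nhds _ F.totalTopology ⟨x, w⟩)) :
    Tendsto (fun z => (⟨p z, a • f z + b • g z⟩ : Bundle.TotalSpace Unit H)) l
      (@nhds _ F.totalTopology ⟨x, a • v + b • w⟩) := by
  have key : ∀ {ε : ℝ} {y : X} {v w v' w' : H y}, ‖v - v'‖ < ε → ‖w - w'‖ < ε →
      ‖a • v + b • w - (a • v' + b • w')‖ ≤ (|a| + |b|) * ε := by
    intro ε y v w v' w' hv hw
    have : a • v + b • w - (a • v' + b • w') = a • (v - v') + b • (w - w') := by module
    rw [this]
    refine (norm_add_le _ _).trans ?_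
    rw [norm_smul, norm_smul, Real.norm_eq_abs, Real.norm_eq_abs, add_mul]
    gcongr
  intro O hO
  obtain ⟨δ, hδ, h⟩ := F.mem_nhds_iff.1 hO
  have hC : 0 < |a| + |b| + 1 := by positivity
  -- The added `1` avoids division by zero when `a = b = 0` and makes the final estimate strict.
  set ε := δ / (|a| + |b| + 1) with hε
  have hε0 : 0 < ε := by positivity
  have hlt : (|a| + |b|) * ε < δ := by
    have : (|a| + |b| + 1) * ε = δ := by rw [hε]; field_simp
    linarith
  obtain ⟨s, t, ht⟩ := F.exists_norm_sub_lt x v ε hε0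
  obtain ⟨s', t', ht'⟩ := F.exists_norm_sub_lt x w ε hε0
  obtain ⟨s'', m, hm, hmΦ⟩ := F.exists_linear_comb a b s s'
  obtain ⟨V, hV, hVO⟩ := h s'' (m x t t') (by rw [hmΦ]; exact (key ht ht').trans_lt hlt)
  obtain ⟨V₁, hV₁, V₂, hV₂, hVV⟩ :=
    FibreProd.exists_of_mem_nhds (hm.continuousAt (x := ⟨t, t'⟩) hV)
  change ∀ᶠ z in l, (⟨p z, a • f z + b • g z⟩ : Bundle.TotalSpace Unit H) ∈ O
  filter_upwards [hf (F.tube_mem_nhds ht hV₁), hg (F.tube_mem_nhds ht' hV₂)]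
    with z ⟨t₁, ht₁, h₁⟩ ⟨t₂, ht₂, h₂⟩
  refine hVO ⟨m _ t₁ t₂, hVV _ t₁ t₂ ht₁ ht₂, ?_⟩
  rw [hmΦ]
  exact (key h₁ h₂).trans_lt hlt

theorem total_tendsto_zero (x : X) :
    comap (fun b : Bundle.TotalSpace Unit H => b.proj) (𝓝 x) ⊓
      comap (fun b : Bundle.TotalSpace Unit H => ‖b.snd‖) (𝓝 0) ≤
        @nhds _ F.totalTopology ⟨x, 0⟩ := by
  intro O hO
  obtain ⟨δ, hδ, h⟩ := F.mem_nhds_iff.1 hO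
  -- The zero section need not be among the families, so `0` is approximated by a value of norm
  -- below `δ / 2`; the other half bounds `b`.
  obtain ⟨s, t, ht⟩ := F.exists_norm_sub_lt x 0 (δ / 2) (half_pos hδ)
  obtain ⟨V, hV, hVO⟩ := h s t (ht.trans (half_lt_self hδ))
  rw [zero_sub, norm_neg] at ht
  have h1 := (F.isOpenMap_proj s).image_mem_nhds
    (inter_mem hV ((F.continuous_norm s).continuousAt.eventually_lt_const ht))
  refine mem_inf_of_inter (preimage_mem_comap h1)
    (preimage_mem_comap (Metric.ball_mem_nhds 0 (half_pos hδ))) ?_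
  rintro ⟨y, b⟩ ⟨⟨⟨y', t'⟩, ⟨ht', hn⟩, hy⟩, hb⟩
  obtain rfl : y' = y := hy
  refine hVO ⟨t', ht', ?_⟩
  have hb' : ‖b‖ < δ / 2 := by simpa using hb
  have hn' : ‖F.Φ t'‖ < δ / 2 := hn
  change ‖b - F.Φ t'‖ < δ
  linarith [norm_sub_le b (F.Φ t')]

/-- If the neighbourhood filters of two points meet, their base points agree because `X` is
Hausdorff. Along the common filter the norm of `b - b` tends both to `0` and to `‖v - w‖`. -/
theorem t2Space_total [T2Space X] : @T2Space _ F.totalTopology := by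
  let _ := F.totalTopology
  refine t2_iff_nhds.2 fun {b b'} hne => ?_
  obtain ⟨x, v⟩ := b
  obtain ⟨y, w⟩ := b'
  have hx := F.continuous_total_proj.continuousAt.tendsto.mono_left
    (inf_le_left : 𝓝 (⟨x, v⟩ : Bundle.TotalSpace Unit H) ⊓ 𝓝 ⟨y, w⟩ ≤ _)
  have hy := F.continuous_total_proj.continuousAt.tendsto.mono_left
    (inf_le_right : 𝓝 (⟨x, v⟩ : Bundle.TotalSpace Unit H) ⊓ 𝓝 ⟨y, w⟩ ≤ _)
  obtain rfl : x = y := tendsto_nhds_unique hx hy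
  have h := F.tendsto_linear_comb 1 (-1) (p := fun b : Bundle.TotalSpace Unit H => b.proj)
    (f := fun b => b.snd) (g := fun b => b.snd) (tendsto_id.mono_left (inf_le_left :
      𝓝 (⟨x, v⟩ : Bundle.TotalSpace Unit H) ⊓ 𝓝 ⟨x, w⟩ ≤ _)) (tendsto_id.mono_left inf_le_right)
  have h2 := (F.continuous_total_norm.tendsto _).comp h
  have h3 : ‖(1 : ℝ) • v + (-1 : ℝ) • w‖ = 0 := by
    refine tendsto_nhds_unique h2 ?_
    simp [Function.comp_def]
  rw [norm_eq_zero, one_smul, neg_one_smul, ← sub_eq_add_neg, sub_eq_zero] at h3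
  rw [h3]

/-- The Hilbert bundle defined by a generating family. -/
def toHilbertBundle [T2Space X] [∀ x, CompleteSpace (H x)] : HilbertBundle X :=
  letI := F.totalTopology
  haveI := F.t2Space_total
  { fibre := H
    continuous_proj := F.continuous_total_proj
    isOpenMap_proj := F.isOpenMap_total_proj
    continuous_norm := F.continuous_total_norm
    continuous_add := by
      refine continuous_iff_continuousAt.2 fun q => ?_
      have h : Tendsto (fun q : FibrePair H => ((⟨q.base, q.fst⟩, ⟨q.base, q.snd⟩) :
          Bundle.TotalSpace Unit H × Bundle.TotalSpace Unit H)) (𝓝 q) (𝓝 _) :=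
        continuous_induced_dom.tendsto q
      rw [nhds_prod_eq, tendsto_prod_iff'] at h
      simpa [ContinuousAt] using F.tendsto_linear_comb 1 1 h.1 h.2
    continuous_smul := fun a => by
      refine continuous_iff_continuousAt.2 fun b => ?_
      -- Scaling is treated as the combination `a • b + 0 • b`.
      simpa [ContinuousAt] using F.tendsto_linear_comb a 0 (l := 𝓝 b)
        (p := fun b : Bundle.TotalSpace Unit H => b.proj)
        (f := fun b => b.snd) (g := fun b => b.snd) tendsto_id tendsto_id
    tendsto_zero := F.total_tendsto_zero }

end GeneratingFamily

end Generating

/-! ## Continuity of maps determined by a total section -/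

theorem exists_norm_sub_linear_comb_lt {S F : Type*} [NormedAddCommGroup F] [InnerProductSpace ℝ F]
    {a : S → F} (ha : Dense (Submodule.span ℝ (Set.range a) : Set F)) (v : F) {ε : ℝ}
    (hε : 0 < ε) : ∃ (n : ℕ) (ζ : Fin n → ℝ) (t : Fin n → S), ‖v - ∑ i, ζ i • a (t i)‖ < ε := by
  obtain ⟨w, hw, hlt⟩ := Metric.dense_iff.1 ha v ε hε
  obtain ⟨n, ζ, g, rfl⟩ := Submodule.mem_span_set'.1 hlt
  choose t ht using fun i => (g i).2
  refine ⟨n, ζ, t, ?_⟩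
  simp_rw [ht]
  rwa [Metric.mem_ball, dist_comm, dist_eq_norm] at hw

section Continuity

variable {X : Type*} [Groupoid X] [TopologicalSpace X] [TopologicalSpace (Arr X)]
  [IsTopologicalGroupoid X]

theorem IsTopologicalGroupoid.continuous_comp {Z : Type*} [TopologicalSpace Z] {x y z : Z → X}
    {f : ∀ q, y q ⟶ z q} {g : ∀ q, x q ⟶ y q} (hf : Continuous fun q => (⟨f q⟩ : Arr X))
    (hg : Continuous fun q => (⟨g q⟩ : Arr X)) : Continuous fun q => (⟨g q ≫ f q⟩ : Arr X) :=
  continuous_mul.comp (g := fun p : ComposablePair X => (⟨p.right ≫ p.left⟩ : Arr X))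
    (f := fun q => ⟨f q, g q⟩) (continuous_induced_rng.2 (hf.prodMk hg))

theorem RFibreTuple.continuous_invMul {ι : Type*} (i j : ι) :
    Continuous fun t : Bundle.TotalSpace Unit (RFibreTuple (X := X) ι) =>
      (t.snd i).invMul (t.snd j) :=
  IsTopologicalGroupoid.continuous_comp
    (IsTopologicalGroupoid.continuous_inv.comp (RFibreTuple.continuous_apply i))
    (RFibreTuple.continuous_apply j)

/-- The linear combination with coefficients `ζ` of the values of `c` on a tuple. -/
def RFibreTuple.sum {X ι : Type*} [Groupoid X] [Fintype ι] {H : X → Type*}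
    [∀ x, AddCommGroup (H x)] [∀ x, Module ℝ (H x)] (c : ∀ x, RFibre x → H x) (ζ : ι → ℝ) (x : X)
    (t : RFibreTuple ι x) : H x :=
  ∑ i, ζ i • c x (t i)

/-- Concatenation of tuples. -/
def RFibreTuple.append {X ι ι' : Type*} [Groupoid X] {x : X} (t : RFibreTuple ι x)
    (t' : RFibreTuple ι' x) : RFibreTuple (ι ⊕ ι') x :=
  Sum.elim t t'

theorem RFibreTuple.sum_append {X ι ι' : Type*} [Groupoid X] [Fintype ι] [Fintype ι']
    {H : X → Type*} [∀ x, AddCommGroup (H x)] [∀ x, Module ℝ (H x)] (c : ∀ x, RFibre x → H x)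
    (ζ : ι → ℝ) (ζ' : ι' → ℝ) {x : X} (t : RFibreTuple ι x) (t' : RFibreTuple ι' x) :
    RFibreTuple.sum c (Sum.elim ζ ζ') x (t.append t') =
      RFibreTuple.sum c ζ x t + RFibreTuple.sum c ζ' x t' :=
  Fintype.sum_sum_type _

theorem RFibreTuple.sum_smul {X ι : Type*} [Groupoid X] [Fintype ι]
    {H : X → Type*} [∀ x, AddCommGroup (H x)] [∀ x, Module ℝ (H x)] (c : ∀ x, RFibre x → H x)
    (a : ℝ) (ζ : ι → ℝ) {x : X} (t : RFibreTuple ι x) :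
    RFibreTuple.sum c (a • ζ) x t = a • RFibreTuple.sum c ζ x t := by
  simp [RFibreTuple.sum, Finset.smul_sum, mul_smul]

theorem RFibreTuple.continuous_append {X ι ι' : Type*} [Groupoid X] [TopologicalSpace X]
    [TopologicalSpace (Arr X)] :
    Continuous fun q : FibreProd (RFibreTuple (X := X) ι) (RFibreTuple ι') =>
      (⟨q.base, q.fst.append q.snd⟩ : Bundle.TotalSpace Unit (RFibreTuple (ι ⊕ ι'))) := by
  have hl : Continuous fun q : FibreProd (RFibreTuple (X := X) ι) (RFibreTuple ι') =>
    (⟨q.base, q.fst⟩ : Bundle.TotalSpace Unit (RFibreTuple ι)) := FibreProd.continuous_left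
  have hr : Continuous fun q : FibreProd (RFibreTuple (X := X) ι) (RFibreTuple ι') =>
    (⟨q.base, q.snd⟩ : Bundle.TotalSpace Unit (RFibreTuple ι')) := FibreProd.continuous_right
  refine continuous_induced_rng.2
    ((RFibreTuple.continuous_proj.comp hl).prodMk (continuous_pi fun i => ?_))
  cases i with
  | inl i => exact (RFibreTuple.continuous_apply i).comp hl
  | inr i => exact (RFibreTuple.continuous_apply i).comp hr

theorem RFibreTuple.exists_norm_sub_sum_lt {X : Type*} [Groupoid X] {H : X → Type*}
    [∀ x, NormedAddCommGroup (H x)] [∀ x, InnerProductSpace ℝ (H x)] {c : ∀ x, RFibre x → H x}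
    {x : X} (h : Dense (Submodule.span ℝ (Set.range (c x)) : Set (H x))) (v : H x) {ε : ℝ}
    (hε : 0 < ε) : ∃ (n : ℕ) (ζ : Fin n → ℝ) (t : RFibreTuple (Fin n) x),
      ‖v - RFibreTuple.sum c ζ x t‖ < ε :=
  exists_norm_sub_linear_comb_lt h v hε

namespace HilbertBundle

variable {E : HilbertBundle X} {c : ∀ x, RFibre x → E.fibre x}

theorem continuous_tuple_sum
    (hc : Continuous fun γ : Arr X => (⟨γ.rng, c γ.rng ⟨γ.hom⟩⟩ : E.Total))
    {ι : Type*} [Fintype ι] (ζ : ι → ℝ) :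
    Continuous fun t : Bundle.TotalSpace Unit (RFibreTuple (X := X) ι) =>
      (⟨t.proj, RFibreTuple.sum c ζ t.proj t.snd⟩ : E.Total) :=
  E.continuous_sum RFibreTuple.continuous_proj ζ (F := fun i t => c t.proj (t.snd i))
    fun i => hc.comp (RFibreTuple.continuous_apply i)

/-- A fibrewise linear isometry is continuous if it maps a total continuous section to a continuous
section. -/
theorem continuous_of_total_section (hr : IsOpenMap fun γ : Arr X => γ.rng)
    (hc : Continuous fun γ : Arr X => (⟨γ.rng, c γ.rng ⟨γ.hom⟩⟩ : E.Total))
    (htot : ∀ x, Dense (Submodule.span ℝ (Set.range (c x)) : Set (E.fibre x)))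
    {E' : HilbertBundle X} {c' : ∀ x, RFibre x → E'.fibre x}
    (hc' : Continuous fun γ : Arr X => (⟨γ.rng, c' γ.rng ⟨γ.hom⟩⟩ : E'.Total))
    (u : ∀ x, E.fibre x →ₗᵢ[ℝ] E'.fibre x) (hu : ∀ x γ, u x (c x γ) = c' x γ) :
    Continuous fun b : E.Total => (⟨b.proj, u b.proj b.snd⟩ : E'.Total) := by
  refine continuous_iff_continuousAt.2 fun b => E'.tendsto_of_approx E.continuous_proj.continuousAt
    fun ε hε => ?_
  obtain ⟨x, v⟩ := b
  obtain ⟨n, ζ, t, ht⟩ := RFibreTuple.exists_norm_sub_sum_lt (htot x) v hε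
  -- On the approximating sums `u` acts by replacing `c` with `c'`, and the resulting sums are
  -- already continuous in the tuple.
  have hsum : ∀ (y : X) (t : RFibreTuple (Fin n) y),
      RFibreTuple.sum c' ζ y t = u y (RFibreTuple.sum c ζ y t) := fun y t => by
    simp [RFibreTuple.sum, hu]
  refine ⟨RFibreTuple.sum c' ζ x t, ?_, fun O hO => ?_⟩
  · change ‖u x v - _‖ < ε
    rwa [hsum, ← map_sub, LinearIsometry.norm_map]
  · have hV := (continuous_tuple_sum hc' ζ).continuousAt
      (x := (⟨x, t⟩ : Bundle.TotalSpace Unit (RFibreTuple (Fin n)))) hO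
    filter_upwards [E.eventually_exists_norm_sub_lt (Φ := RFibreTuple.sum c ζ)
      (RFibreTuple.isOpenMap_proj hr) (continuous_tuple_sum hc ζ) ht hV] with b ⟨t', ht', hlt⟩
    refine ⟨_, ht', ?_⟩
    rw [hsum, ← map_sub, LinearIsometry.norm_map]
    exact hlt

/-- An action by isometries on a Hilbert bundle is continuous if a total continuous section is a
cocycle. -/
theorem continuous_action_of_cocycle (hr : IsOpenMap fun γ : Arr X => γ.rng)
    (hc : Continuous fun γ : Arr X => (⟨γ.rng, c γ.rng ⟨γ.hom⟩⟩ : E.Total))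
    (htot : ∀ x, Dense (Submodule.span ℝ (Set.range (c x)) : Set (E.fibre x)))
    (L : ∀ {x y : X}, (x ⟶ y) → (E.fibre x →ₗᵢ[ℝ] E.fibre y))
    (hL : ∀ {x y : X} (γ : x ⟶ y) (γ' : RFibre x),
      c y (γ'.translate γ) = c y ⟨γ⟩ + L γ (c x γ')) :
    Continuous fun p : ActionPair E.fibre => (⟨p.y, L p.arrow p.vec⟩ : E.Total) := by
  have hp : Continuous fun p : ActionPair E.fibre =>
      ((⟨p.arrow⟩, ⟨p.x, p.vec⟩) : Arr X × E.Total) := continuous_induced_dom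
  refine continuous_iff_continuousAt.2 fun p => E.tendsto_of_approx
    (IsTopologicalGroupoid.continuous_rng.comp hp.fst).continuousAt fun ε hε => ?_
  obtain ⟨γ, v⟩ := p
  rename_i x y
  obtain ⟨n, ζ, t, ht⟩ := RFibreTuple.exists_norm_sub_sum_lt (htot x) v hε
  have hq : Continuous fun q : ActionPair (RFibreTuple (X := X) (Fin n)) =>
      ((⟨q.arrow⟩, ⟨q.x, q.vec⟩) : Arr X × Bundle.TotalSpace Unit (RFibreTuple (Fin n))) :=
    continuous_induced_dom
  have hM : Continuous fun q : ActionPair (RFibreTuple (X := X) (Fin n)) =>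
      (⟨q.y, L q.arrow (RFibreTuple.sum c ζ q.x q.vec)⟩ : E.Total) := by
    -- The cocycle identity removes `L`: on sums it is expressed through `c` at translated arrows
    -- and at the acting arrow, which depend continuously on the pair.
    have h1 : ∀ q : ActionPair (RFibreTuple (X := X) (Fin n)),
        L q.arrow (RFibreTuple.sum c ζ q.x q.vec) =
          ∑ i, ζ i • (c q.y (RFibre.translate q.arrow (q.vec i)) +
            (-1 : ℝ) • c q.y ⟨q.arrow⟩) := fun q => by
      simp [RFibreTuple.sum, hL]
    simp only [h1]
    refine E.continuous_sum (IsTopologicalGroupoid.continuous_rng.comp hq.fst) ζ fun i =>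
      continuous_iff_continuousAt.2 fun q => E.tendsto_add
        (Continuous.tendsto (f := fun q : ActionPair (RFibreTuple (X := X) (Fin n)) =>
          (⟨q.y, c q.y (RFibre.translate q.arrow (q.vec i))⟩ : E.Total)) ?_ q)
        (E.tendsto_smul (-1) ((hc.comp hq.fst).tendsto q))
    exact hc.comp (IsTopologicalGroupoid.continuous_comp hq.fst
      ((RFibreTuple.continuous_apply i).comp hq.snd))
  refine ⟨L γ (RFibreTuple.sum c ζ x t), ?_, fun O hO => ?_⟩
  · rw [← map_sub, LinearIsometry.norm_map]
    exact ht
  · have hA := hM.continuousAt (x := ⟨γ, t⟩) hO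
    rw [mem_map, nhds_induced, nhds_prod_eq, mem_comap] at hA
    obtain ⟨B, hB, hBA⟩ := hA
    obtain ⟨V₁, hV₁, V₂, hV₂, hV⟩ := mem_prod_iff.1 hB
    have h1 := (hp.snd.tendsto ⟨γ, v⟩).eventually
      (E.eventually_exists_norm_sub_lt (Φ := RFibreTuple.sum c ζ) (RFibreTuple.isOpenMap_proj hr)
        (continuous_tuple_sum hc ζ) ht hV₂)
    filter_upwards [hp.fst.continuousAt.eventually_mem hV₁, h1] with q hq ⟨t', ht', hlt⟩
    have hm : (((⟨q.arrow⟩, ⟨q.x, t'⟩) : Arr X × Bundle.TotalSpace Unit (RFibreTuple (Fin n)))) ∈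
      B := hV ⟨hq, ht'⟩
    refine ⟨_, hBA (a := ⟨q.arrow, t'⟩) hm, ?_⟩
    rw [← map_sub, LinearIsometry.norm_map]
    exact hlt

end HilbertBundle

end Continuity

/-! ## The Hilbert bundle of a function conditionally of negative type -/

section Construction

variable {X : Type*} [Groupoid X] {ψ : Arr X → ℝ}

theorem RFibre.invMul_self {x : X} (γ : RFibre x) : γ.invMul γ = ⟨𝟙 γ.src⟩ := by
  simp [RFibre.invMul]

theorem IsCNT.apply_unit (h : IsCNT ψ) (x : X) : ψ ⟨𝟙 x⟩ = 0 := by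
  have := (h x).diag ⟨𝟙 x⟩
  rwa [RFibre.invMul_self] at this

theorem IsCNT.isPosKernel (h : IsCNT ψ) (x : X) : IsPosKernel fun γ γ' : RFibre x =>
    (ψ γ.toArr + ψ γ'.toArr - ψ (γ.invMul γ')) / 2 := by
  have h1 : ∀ γ : RFibre x, RFibre.invMul ⟨𝟙 x⟩ γ = γ.toArr := fun γ => by
    simp [RFibre.invMul, RFibre.toArr]
  have := (h x).isPosKernel ⟨𝟙 x⟩
  simpa only [h1] using this

variable [TopologicalSpace X] [TopologicalSpace (Arr X)] [IsTopologicalGroupoid X]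

/-- Coefficients of a linear combination. -/
structure Coefficients where
  ι : Type
  [fintype : Fintype ι]
  coeff : ι → ℝ

instance (s : Coefficients) : Fintype s.ι := s.fintype

/-- The linear combinations of the canonical vectors in the Hilbert spaces defined by a function
conditionally of negative type. -/
noncomputable def IsCNT.generatingFamily (h : IsCNT ψ) (hψ : Continuous ψ)
    (hr : IsOpenMap fun γ : Arr X => γ.rng) :
    GeneratingFamily fun x => (h.isPosKernel x).Space where
  σ := Coefficients
  T s x := RFibreTuple s.ι x
  Φ {s x} t := RFibreTuple.sum (fun x => (h.isPosKernel x).feature) s.coeff x t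
  continuous_proj _ := RFibreTuple.continuous_proj
  isOpenMap_proj _ := RFibreTuple.isOpenMap_proj hr
  continuous_norm s := by
    -- The squared norm becomes a finite combination of values of `ψ` at `γᵢ`, `γⱼ` and `γᵢ⁻¹γⱼ`.
    simp_rw [RFibreTuple.sum, norm_eq_sqrt_real_inner, sum_inner, inner_sum, inner_smul_left, inner_smul_right,
      IsPosKernel.inner_feature]
    have h1 := fun i : s.ι => hψ.comp (RFibreTuple.continuous_apply (X := X) i)
    have h2 := fun i j : s.ι => hψ.comp (RFibreTuple.continuous_invMul (X := X) i j)
    refine Real.continuous_sqrt.comp (continuous_finsetSum _ fun i _ =>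
      continuous_finsetSum _ fun j _ => ?_)
    exact continuous_const.mul (continuous_const.mul ((((h1 i).add (h1 j)).sub (h2 i j)).div_const 2))
  exists_linear_comb a b s s' :=
    ⟨⟨s.ι ⊕ s'.ι, Sum.elim (a • s.coeff) (b • s'.coeff)⟩, fun _ t t' => t.append t',
      RFibreTuple.continuous_append, fun x t t' =>
        (RFibreTuple.sum_append (fun x => (h.isPosKernel x).feature) _ _ t t').trans
          (congrArg₂ (· + ·) (RFibreTuple.sum_smul _ _ _ _) (RFibreTuple.sum_smul _ _ _ _))⟩
  exists_norm_sub_lt x v ε hε := by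
    obtain ⟨n, ζ, t, ht⟩ := RFibreTuple.exists_norm_sub_sum_lt
      (c := fun x => (h.isPosKernel x).feature) (h.isPosKernel x).dense_span_feature v hε
    exact ⟨⟨Fin n, ζ⟩, t, ht⟩

theorem IsCNT.exists_hilbertBundle {X : Type u} [Groupoid.{v} X] [TopologicalSpace X]
    [TopologicalSpace (Arr X)] [IsTopologicalGroupoid X] [T2Space X] {ψ : Arr X → ℝ}
    (h : IsCNT ψ) (hψ : Continuous ψ) (hr : IsOpenMap fun γ : Arr X => γ.rng) :
    ∃ (E : HilbertBundle.{u, max u v} X) (c : ∀ x, RFibre x → E.fibre x),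
      (Continuous fun γ : Arr X => (⟨γ.rng, c γ.rng ⟨γ.hom⟩⟩ : E.Total)) ∧
      (∀ x, Dense (Submodule.span ℝ (Set.range (c x)) : Set (E.fibre x))) ∧
      ∀ (x : X) (γ γ' : RFibre x),
        inner ℝ (c x γ) (c x γ') = (ψ γ.toArr + ψ γ'.toArr - ψ (γ.invMul γ')) / 2 := by
  let F := h.generatingFamily hψ hr
  refine ⟨F.toHilbertBundle, fun x => (h.isPosKernel x).feature, ?_,
    fun x => (h.isPosKernel x).dense_span_feature, fun x => (h.isPosKernel x).inner_feature⟩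
  -- The section `c` is itself the generating family with one arrow and coefficient `1`, hence
  -- continuous.
  let s : F.σ := (⟨Unit, fun _ => 1⟩ : Coefficients)
  let _ := F.totalTopology
  have h1 : Continuous[_, F.topology s] fun γ : Arr X =>
      (⟨γ.rng, fun _ => ⟨γ.hom⟩⟩ : Bundle.TotalSpace Unit (RFibreTuple (X := X) Unit)) :=
    continuous_induced_rng.2
      (IsTopologicalGroupoid.continuous_rng.prodMk (continuous_pi fun _ => continuous_id))
  refine ((F.continuous_Φ s).comp h1).congr fun γ =>
    congrArg (Bundle.TotalSpace.mk γ.rng) ?_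
  change ∑ i : Unit, (1 : ℝ) • (h.isPosKernel γ.rng).feature ⟨γ.hom⟩ = _
  simp

theorem IsCNT.exists_representation {X : Type u} [Groupoid.{v} X] [TopologicalSpace X]
    [TopologicalSpace (Arr X)] [IsTopologicalGroupoid X] [T2Space X] {ψ : Arr X → ℝ}
    (h : IsCNT ψ) (hψ : Continuous ψ) (hr : IsOpenMap fun γ : Arr X => γ.rng) :
    ∃ (E : GHilbertBundle.{u, v, max u v} X) (c : ContinuousCocycle E), Represents E c ψ := by
  obtain ⟨E, c, hc, htot, hinner⟩ := h.exists_hilbertBundle hψ hr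
  -- In the inner product of `c(γα) - c(γ)` and `c(γβ) - c(γ)`, all values of `ψ` at `γ`, `γα` and
  -- `γβ` cancel; symmetry `ψ(α⁻¹) = ψ(α)` then gives `K(α,β)`.
  have hL : ∀ (x y : X) (γ : x ⟶ y), ∃ L : E.fibre x →ₗᵢ[ℝ] E.fibre y, ∀ γ' : RFibre x,
      L (c x γ') = c y (γ'.translate γ) - c y ⟨γ⟩ := fun x y γ => by
    refine exists_linearIsometry_of_inner_eq (htot x) fun α β => ?_
    simp only [inner_sub_left, inner_sub_right, hinner, RFibre.translate, RFibre.invMul,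
      RFibre.toArr, Groupoid.inv_eq_inv, IsIso.inv_comp, Category.assoc, IsIso.hom_inv_id,
      Category.comp_id, IsIso.hom_inv_id_assoc, h.apply_unit]
    have := (h x).symm ⟨𝟙 x⟩ α
    simp only [RFibre.invMul, Groupoid.inv_eq_inv, IsIso.inv_id, Category.comp_id,
      Category.id_comp] at this
    rw [← this]
    ring
  choose L hL using hL
  have hL' : ∀ {x y : X} (γ : x ⟶ y) (γ' : RFibre x),
      c y (γ'.translate γ) = c y ⟨γ⟩ + L x y γ (c x γ') := fun γ γ' => by
    rw [hL, add_sub_cancel]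
  -- `L(1)` sends this vector to `c(1) - c(1) = 0` and is injective.
  have hunit : ∀ x, c x ⟨𝟙 x⟩ = 0 := fun x => by
    have := hL x x (𝟙 x) ⟨𝟙 x⟩
    simp only [RFibre.translate, Category.comp_id, sub_self] at this
    exact (L x x (𝟙 x)).injective (this.trans (map_zero _).symm)
  refine ⟨{ E with
      L := fun {x y} => L x y
      L_id := fun x v => ?_
      L_comp := fun {x y z} γ' γ v => ?_
      continuous_action := HilbertBundle.continuous_action_of_cocycle hr hc htot (fun {x y} => L x y) hL' },
    ⟨fun γ => c γ.rng ⟨γ.hom⟩, fun γ γ' => hL' γ ⟨γ'⟩, hc⟩, ⟨fun γ => ?_, htot⟩⟩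
  · refine LinearIsometry.ext_of_dense_span (htot x) (u := L x x (𝟙 x)) (u' := LinearIsometry.id)
      (fun γ => ?_) v
    simp [hL, hunit, RFibre.translate]
  · refine LinearIsometry.ext_of_dense_span (htot x) (u := L x z (γ' ≫ γ))
      (u' := (L y z γ).comp (L x y γ')) (fun α => ?_) v
    have := hL y z γ ⟨γ'⟩
    simp [hL, RFibre.translate, map_sub] at this ⊢
  · change _ = ‖c γ.rng ⟨γ.hom⟩‖ ^ 2
    rw [← real_inner_self_eq_norm_sq, hinner, RFibre.invMul_self, h.apply_unit]
    simp [RFibre.toArr]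

end Construction

/-! ## Uniqueness -/

section Uniqueness

variable {X : Type*} [Groupoid X] [TopologicalSpace X] [TopologicalSpace (Arr X)]
  {ψ : Arr X → ℝ}

/-- The restriction of a cocycle to the arrows with range `x`. -/
def ContinuousCocycle.onFibre {E : GHilbertBundle X} (c : ContinuousCocycle E) (x : X)
    (γ : RFibre x) : E.fibre x :=
  c.toFun γ.toArr

theorem ContinuousCocycle.onFibre_translate {E : GHilbertBundle X} (c : ContinuousCocycle E)
    {x y : X} (γ : x ⟶ y) (γ' : RFibre x) :
    c.onFibre y (γ'.translate γ) = c.onFibre y ⟨γ⟩ + E.L γ (c.onFibre x γ') :=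
  c.cocycle γ γ'.hom

theorem Represents.norm_onFibre_sq {E : GHilbertBundle X} {c : ContinuousCocycle E}
    (h : Represents E c ψ) {x : X} (γ : RFibre x) : ‖c.onFibre x γ‖ ^ 2 = ψ γ.toArr :=
  (h.norm_sq γ.toArr).symm

/-- Writing `γ' = γ(γ⁻¹γ')`, the cocycle identity gives `c(γ') - c(γ) = L(γ)c(γ⁻¹γ')`, of squared
norm `ψ(γ⁻¹γ')`; polarization does the rest. -/
theorem Represents.inner_eq {E : GHilbertBundle X} {c : ContinuousCocycle E}
    (h : Represents E c ψ) {x : X} (γ γ' : RFibre x) :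
    inner ℝ (c.onFibre x γ) (c.onFibre x γ') =
      (ψ γ.toArr + ψ γ'.toArr - ψ (γ.invMul γ')) / 2 := by
  have h1 := c.onFibre_translate γ.hom ⟨γ'.hom ≫ Groupoid.inv γ.hom⟩
  simp only [RFibre.translate, Category.assoc, Groupoid.inv_comp, Category.comp_id] at h1
  have h2 : ‖c.onFibre x γ' - c.onFibre x γ‖ ^ 2 = ψ (γ.invMul γ') := by
    rw [h1, add_sub_cancel_left, LinearIsometry.norm_map, h.norm_onFibre_sq]
    rfl
  have h3 := norm_sub_sq_real (c.onFibre x γ') (c.onFibre x γ)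
  rw [h2, h.norm_onFibre_sq, h.norm_onFibre_sq, real_inner_comm] at h3
  linarith

theorem Represents.exists_equivariantIsometry [IsTopologicalGroupoid X]
    (hr : IsOpenMap fun γ : Arr X => γ.rng) {E E' : GHilbertBundle X} {c : ContinuousCocycle E}
    {c' : ContinuousCocycle E'} (h : Represents E c ψ) (h' : Represents E' c' ψ) :
    ∃ u : EquivariantIsometry E E', ∀ γ : Arr X, c'.toFun γ = u.toFun γ.rng (c.toFun γ) := by
  have hu : ∀ x : X, ∃ u : E.fibre x →ₗᵢ[ℝ] E'.fibre x, ∀ γ : RFibre x,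
      u (c.onFibre x γ) = c'.onFibre x γ := fun x =>
    exists_linearIsometry_of_inner_eq (h.total x) fun γ γ' =>
      (h.inner_eq γ γ').trans (h'.inner_eq γ γ').symm
  choose u hu using hu
  refine ⟨⟨u, fun {x y} γ v => ?_, HilbertBundle.continuous_of_total_section hr
    (c := c.onFibre) (c' := c'.onFibre) c.continuous h.total c'.continuous u hu⟩,
    fun γ => (hu γ.rng ⟨γ.hom⟩).symm⟩
  refine LinearIsometry.ext_of_dense_span (h.total x) (u := (u y).comp (E.L γ))
    (u' := (E'.L γ).comp (u x)) (fun γ' => ?_) v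
  -- Equivariance on the total set follows by applying `u` to the cocycle identity of `c` and
  -- subtracting that of `c'`.
  have h1 := congrArg (u y) (c.onFibre_translate γ γ')
  rw [map_add, hu, hu, c'.onFibre_translate] at h1
  change u y (E.L γ (c.onFibre x γ')) = E'.L γ (u x (c.onFibre x γ'))
  rw [hu]
  exact (add_left_cancel h1).symm

end Uniqueness

/-- The fibres constructed for existence live in the universe `max u v` of `RFibre x`, while
uniqueness compares bundles with fibres in arbitrary universes. -/
theorem mainTheorem3 (X : Type u) [Groupoid.{v} X] [TopologicalSpace X]
    [TopologicalSpace (Arr X)] [IsTopologicalGroupoid X]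
    [LocallyCompactSpace (Arr X)] [T2Space (Arr X)] [SecondCountableTopology (Arr X)]
    (lam : HaarSystem X) (ψ : Arr X → ℝ) (hψ : Continuous ψ) (hcnt : IsCNT ψ) :
    (∃ (E : GHilbertBundle.{u, v, max u v} X) (c : ContinuousCocycle E), Represents E c ψ) ∧
    (∀ (E : GHilbertBundle.{u, v, w} X) (c : ContinuousCocycle E)
      (E' : GHilbertBundle.{u, v, w'} X) (c' : ContinuousCocycle E'),
      Represents E c ψ → Represents E' c' ψ →
        ∃ u : EquivariantIsometry E E', ∀ γ : Arr X, c'.toFun γ = u.toFun γ.rng (c.toFun γ)) := by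
  have hr := lam.isOpenMap_rng
  have : T2Space X := IsTopologicalGroupoid.t2Space_unit
  exact ⟨hcnt.exists_representation hψ hr,
    fun _ _ _ _ h h' => h.exists_equivariantIsometry hr h'⟩
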